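/- Let $N$ be a non-negative integer, $K$ a field, and $X=(x_1,\dots,x_{N-1})$, $Y=(y_1,\dots,y_{N-2})$ sequences in $K$ with $x_i$ arbitrary and all $y_i\neq 0$. The Okada algebra $O_N(X,Y)$ is the unital associative $K$-algebra generated by $E_1,\dots,E_{N-1}$ with relations $$E_i^2=x_iE_i,\qquad E_iE_j=E_jE_i\ \ (|i-j|\ge 2),\qquad E_{i+1}E_iE_{i+1}=y_iE_{i+1}\ \ (1\le i\le N-2).$$ A Fibonacci set of rank $N$ is a set $S=\{s_1<\dots<s_k\}\subseteq\{1,\dots,N\}$ such that $k\equiv N \pmod 2$ and $s_l\equiv l\pmod 2$ for every $l$. Its free set is $$\mathfrak F(S)=\{\,i\in\{1,\dots,N\} : i-\max\{s\in S: s\le i\}\text{ is odd}\,\},\qquad \max\emptyset:=0.$$ It is contained in $\{1,\dots,N-1\}$ and contains no two consecutive integers, so the free element $E_S=\prod_{i\in\mathfrak F(S)}E_i$ is a well-defined product of commuting generators. Let $\mathfrak J_S$ be the two-sided ideal of $O_N(X,Y)$ generated by $E_S$. For Fibonacci sets $S=\{s_1<\dots<s_k\}$ and $T=\{t_1<\dots<t_\ell\}$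 of rank $N$, write $S\preceq T$ ($S$ is dominated by $T$) if $k\le \ell$ and $s_{k-i}\le t_{\ell-i}$ for all $0\le i<k$. **Proposition.** For all Fibonacci sets $S,T$ of rank $N$, $$\mathfrak J_S\subseteq \mathfrak J_T\quad\Longleftrightarrow\quad S\preceq T.$$ -/

import Mathlib

/-- A Fibonacci set of rank `N`: a subset `{s_1 < ⋯ < s_k}` of `{1, …, N}` such that `k` has
the parity of `N` and each `s_l` has the parity of `l`. In `elt_parity` the index `j` is
`0`-based, so `S.orderEmbOfFin rfl j` is `s_{j+1}`. -/
structure FibonacciSet (N : ℕ) where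
  carrier : Finset ℕ
  subset_Icc : carrier ⊆ Finset.Icc 1 N
  card_parity : carrier.card % 2 = N % 2
  elt_parity : ∀ j : Fin carrier.card,
    carrier.orderEmbOfFin rfl j % 2 = ((j : ℕ) + 1) % 2

namespace FibonacciSet

variable {N : ℕ}

/-- The dominance order `S ⪯ T` for `S = {s_1 < ⋯ < s_k}`, `T = {t_1 < ⋯ < t_l}`:
`k ≤ l` and `s_{k-i} ≤ t_{l-i}` for `0 ≤ i < k`. (The `0`-based index of `s_{k-i}` is
`k - 1 - i`.) -/
def DominatedBy (S T : FibonacciSet N) : Prop :=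
  ∃ hkl : S.carrier.card ≤ T.carrier.card,
    ∀ (i : ℕ) (hi : i < S.carrier.card),
      S.carrier.orderEmbOfFin rfl ⟨S.carrier.card - 1 - i, by omega⟩ ≤
        T.carrier.orderEmbOfFin rfl ⟨T.carrier.card - 1 - i, by omega⟩

/-- The free set `F(S)`: all `i` in `{1, …, N}` for which `i - max {s ∈ S | s ≤ i}` is odd,
where the maximum of the empty set is `0`. -/
def freeSet (S : FibonacciSet N) : Finset ℕ :=
  (Finset.Icc 1 N).filter fun i => Odd (i - (S.carrier.filter (· ≤ i)).sup id)

theorem mem_freeSet_pos {S : FibonacciSet N} {i : ℕ} (hi : i ∈ S.freeSet) : 1 ≤ i :=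
  (Finset.mem_Icc.1 (Finset.mem_filter.1 hi).1).1

theorem mem_freeSet_lt {S : FibonacciSet N} {i : ℕ} (hi : i ∈ S.freeSet) : i < N := by
  obtain ⟨hI, hodd⟩ := Finset.mem_filter.1 hi
  obtain ⟨-, hle⟩ := Finset.mem_Icc.1 hI
  refine lt_of_le_of_ne hle ?_
  rintro rfl
  have hfil : S.carrier.filter (· ≤ i) = S.carrier :=
    Finset.filter_true_of_mem fun s hs => (Finset.mem_Icc.1 (S.subset_Icc hs)).2
  rw [hfil, Nat.odd_iff] at hodd
  have hc := S.card_parity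
  rcases Nat.eq_zero_or_pos S.carrier.card with h0 | hpos
  · rw [Finset.card_eq_zero.1 h0] at hodd
    simp at hodd
    omega
  · have hp := S.elt_parity ⟨S.carrier.card - 1, by omega⟩
    have hne : S.carrier.Nonempty := Finset.card_pos.1 hpos
    rw [Finset.orderEmbOfFin_last rfl hpos, Finset.max'_eq_sup', Finset.sup'_eq_sup] at hp
    have hsup : S.carrier.sup id ≤ i :=
      Finset.sup_le fun s hs => (Finset.mem_Icc.1 (S.subset_Icc hs)).2
    simp only at hp
    omega

theorem succ_notMem_freeSet {S : FibonacciSet N} {i : ℕ} (hi : i ∈ S.freeSet) :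
    i + 1 ∉ S.freeSet := by
  intro hi'
  have h1 := (Finset.mem_filter.1 hi).2
  have h2 := (Finset.mem_filter.1 hi').2
  by_cases hS : i + 1 ∈ S.carrier
  · have : i + 1 ≤ (S.carrier.filter (· ≤ i + 1)).sup id :=
      Finset.le_sup (f := id) (Finset.mem_filter.2 ⟨hS, le_rfl⟩)
    rw [Nat.sub_eq_zero_of_le this] at h2
    simp at h2
  · have hf : S.carrier.filter (· ≤ i + 1) = S.carrier.filter (· ≤ i) := by
      refine Finset.filter_congr fun s hs => ?_
      have : s ≠ i + 1 := fun h => hS (h ▸ hs)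
      omega
    have hsup : (S.carrier.filter (· ≤ i)).sup id ≤ i :=
      Finset.sup_le fun s hs => (Finset.mem_filter.1 hs).2
    rw [hf, Nat.odd_iff] at h2
    rw [Nat.odd_iff] at h1
    omega

end FibonacciSet

/-- The indices `1, …, N - 1` of the generators of the Okada algebra of rank `N`. -/
abbrev OkadaIndex (N : ℕ) : Type := {i : ℕ // 1 ≤ i ∧ i < N}

/-- The defining relations of the Okada algebra, in the free algebra on `E_1, …, E_{N-1}`.
Only the entries `x_1, …, x_{N-1}` and `y_1, …, y_{N-2}` of the sequences `x`, `y` are used. -/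
inductive OkadaRel {K : Type*} [Field K] (N : ℕ) (x y : ℕ → K) :
    FreeAlgebra K (OkadaIndex N) → FreeAlgebra K (OkadaIndex N) → Prop
  | sq (i : OkadaIndex N) :
      OkadaRel N x y (FreeAlgebra.ι K i * FreeAlgebra.ι K i) (x i • FreeAlgebra.ι K i)
  | comm (i j : OkadaIndex N) (hij : (i : ℕ) + 2 ≤ j ∨ (j : ℕ) + 2 ≤ i) :
      OkadaRel N x y (FreeAlgebra.ι K i * FreeAlgebra.ι K j)
        (FreeAlgebra.ι K j * FreeAlgebra.ι K i)
  | contract (i j : OkadaIndex N) (hij : (j : ℕ) = i + 1) :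
      OkadaRel N x y (FreeAlgebra.ι K j * FreeAlgebra.ι K i * FreeAlgebra.ι K j)
        (y i • FreeAlgebra.ι K j)

/-- The Okada algebra `O_N(X, Y)` over the field `K`. -/
abbrev OkadaAlgebra {K : Type*} [Field K] (N : ℕ) (x y : ℕ → K) : Type _ :=
  RingQuot (OkadaRel N x y)

namespace OkadaAlgebra

variable {K : Type*} [Field K] {N : ℕ} (x y : ℕ → K)

/-- The generator `E_i` of the Okada algebra. -/
noncomputable def gen (i : OkadaIndex N) : OkadaAlgebra N x y :=
  RingQuot.mkAlgHom K (OkadaRel N x y) (FreeAlgebra.ι K i)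

theorem gen_commute (i j : OkadaIndex N) (hij : (i : ℕ) + 2 ≤ j ∨ (j : ℕ) + 2 ≤ i) :
    Commute (gen x y i) (gen x y j) := by
  have h := RingQuot.mkAlgHom_rel K (OkadaRel.comm (x := x) (y := y) i j hij)
  simpa [gen, Commute, SemiconjBy] using h

/-- The element of `OkadaIndex N` given by a member of a free set. -/
def freeIndex (S : FibonacciSet N) (i : S.freeSet) : OkadaIndex N :=
  ⟨i, FibonacciSet.mem_freeSet_pos i.2, FibonacciSet.mem_freeSet_lt i.2⟩

theorem gen_freeIndex_commute (S : FibonacciSet N) (i j : S.freeSet) (hij : i ≠ j) :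
    Commute (gen x y (freeIndex S i)) (gen x y (freeIndex S j)) := by
  refine gen_commute x y _ _ ?_
  have h0 : (i : ℕ) ≠ j := fun h => hij (Subtype.ext h)
  have h1 : (j : ℕ) ≠ i + 1 := fun h => FibonacciSet.succ_notMem_freeSet i.2 (h ▸ j.2)
  have h2 : (i : ℕ) ≠ j + 1 := fun h => FibonacciSet.succ_notMem_freeSet j.2 (h ▸ i.2)
  simp only [freeIndex]
  omega

/-- The free element `E_S`, the product of the pairwise commuting generators `E_i` with
`i` in the free set `F(S)`. -/
noncomputable def freeElement (S : FibonacciSet N) : OkadaAlgebra N x y :=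
  S.freeSet.attach.noncommProd (fun i => gen x y (freeIndex S i))
    (fun i _ j _ hij => gen_freeIndex_commute x y S i j hij)

/-- The two-sided ideal `J_S` generated by the free element `E_S`. -/
noncomputable def freeIdeal (S : FibonacciSet N) : TwoSidedIdeal (OkadaAlgebra N x y) :=
  TwoSidedIdeal.span {freeElement x y S}

end OkadaAlgebra

/-! The set {1, …, N} is cut into the elements of S and the pairs {i, i+1} with i free. Counting the
pieces from the right turns dominance into a condition on free sets: S ⪯ T iff, for every m, F(T)
has at most as many elements ≥ m as F(S) (`dominatedBy_iff_card_freeSet_filter_le`).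

Under this condition the relation E_{i+1} E_i E_{i+1} = y_i E_{i+1}, with y_i invertible, allows the
factors of E_T to be raised within J_T, the largest first, to the factors of E_S of the same rank.
The other factors of E_S are then multiplied on (`mul_prod_genAt_mem_of_countP_le`).

Conversely, O_N is graded by every monoid M whose elements e_i satisfy the relations with all
scalars equal to 1. As E_S ≠ 0, which a tower of induced modules shows
(`exists_isOkadaFamily_prod_ne_zero`), J_S ⊆ J_T forces e_S = u e_T w in M
(`exists_eq_mul_mul_of_freeIdeal_le`). For each m, take for M the maps on isotropic subspaces of the
path's adjacency form that never lower the dimension. For i ≥ m let e_i be the reduction W ↦ (W ∩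
v_i^⊥) + ⟨v_i⟩, and for i < m the identity; this cutoff is consistent because E_i E_{i+1} E_i is not
required to contract. Applied to 0, e_S yields dimension at most #{i ∈ F(S) : i ≥ m}, while u e_T w
yields at least #{i ∈ F(T) : i ≥ m}. -/

/-! ### Dominance in terms of counting functions of free sets -/

theorem Finset.le_card_filter_le_iff (A : Finset ℕ) {r : ℕ} (hr : 0 < r) (m : ℕ) :
    r ≤ (A.filter (m ≤ ·)).card ↔
      ∃ h : r ≤ A.card, m ≤ A.orderEmbOfFin rfl ⟨A.card - r, by omega⟩ := by
  constructor
  · intro h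
    have hrA : r ≤ A.card := h.trans (Finset.card_filter_le _ _)
    refine ⟨hrA, ?_⟩
    by_contra! hlt
    have hsub : A.filter (m ≤ ·) ⊆
        (Finset.Ioi (⟨A.card - r, by omega⟩ : Fin A.card)).map
          (A.orderEmbOfFin rfl).toEmbedding := by
      intro a ha
      obtain ⟨haA, hma⟩ := Finset.mem_filter.1 ha
      obtain ⟨j, rfl⟩ : a ∈ Set.range (A.orderEmbOfFin rfl) := by
        rw [Finset.range_orderEmbOfFin]; exact haA
      refine Finset.mem_map.2 ⟨j, ?_, rfl⟩
      rw [Finset.mem_Ioi]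
      exact (A.orderEmbOfFin rfl).lt_iff_lt.1 (hlt.trans_le hma)
    have := Finset.card_le_card hsub
    rw [Finset.card_map, Fin.card_Ioi] at this
    simp only at this
    omega
  · rintro ⟨hrA, hm⟩
    have hsub : (Finset.Ici (⟨A.card - r, by omega⟩ : Fin A.card)).map
          (A.orderEmbOfFin rfl).toEmbedding ⊆ A.filter (m ≤ ·) := by
      intro a ha
      obtain ⟨j, hj, rfl⟩ := Finset.mem_map.1 ha
      refine Finset.mem_filter.2 ⟨Finset.orderEmbOfFin_mem _ _ _, hm.trans ?_⟩
      exact (A.orderEmbOfFin rfl).monotone (Finset.mem_Ici.1 hj)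
    have := Finset.card_le_card hsub
    rw [Finset.card_map, Fin.card_Ici] at this
    simp only at this
    omega

namespace FibonacciSet

theorem dominatedBy_iff_card_filter_le {N : ℕ} {S T : FibonacciSet N} :
    S.DominatedBy T ↔
      ∀ m, (S.carrier.filter (m ≤ ·)).card ≤ (T.carrier.filter (m ≤ ·)).card := by
  constructor
  · rintro ⟨hkl, h⟩ m
    rcases Nat.eq_zero_or_pos (S.carrier.filter (m ≤ ·)).card with h0 | hpos
    · omega
    obtain ⟨hle, hm⟩ := (Finset.le_card_filter_le_iff S.carrier hpos m).1 le_rfl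
    refine (Finset.le_card_filter_le_iff T.carrier hpos m).2 ⟨hle.trans hkl, hm.trans ?_⟩
    have hidx (c : ℕ) : c - 1 - ((S.carrier.filter (m ≤ ·)).card - 1) =
        c - (S.carrier.filter (m ≤ ·)).card := by omega
    simpa only [hidx] using h ((S.carrier.filter (m ≤ ·)).card - 1) (by omega)
  · intro h
    have hkl : S.carrier.card ≤ T.carrier.card := by simpa using h 0
    refine ⟨hkl, fun i hi => ?_⟩
    set m := S.carrier.orderEmbOfFin rfl ⟨S.carrier.card - 1 - i, by omega⟩ with hm
    have h1 : i + 1 ≤ (S.carrier.filter (m ≤ ·)).card := by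
      refine (Finset.le_card_filter_le_iff S.carrier (Nat.succ_pos i) m).2 ⟨hi, le_of_eq ?_⟩
      rw [hm]
      congr 2
      omega
    obtain ⟨_, h2⟩ := (Finset.le_card_filter_le_iff T.carrier (Nat.succ_pos i) m).1 (h1.trans (h m))
    refine h2.trans (le_of_eq ?_)
    congr 2
    omega

theorem card_filter_le_mod_two {N : ℕ} (S : FibonacciSet N) {s : ℕ} (hs : s ∈ S.carrier) :
    (S.carrier.filter (· ≤ s)).card % 2 = s % 2 := by
  obtain ⟨j, rfl⟩ : s ∈ Set.range (S.carrier.orderEmbOfFin rfl) := by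
    rw [Finset.range_orderEmbOfFin]; exact hs
  have heq : S.carrier.filter (· ≤ S.carrier.orderEmbOfFin rfl j) =
      (Finset.Iic j).map (S.carrier.orderEmbOfFin rfl).toEmbedding := by
    ext a
    simp only [Finset.mem_filter, Finset.mem_map, Finset.mem_Iic]
    constructor
    · rintro ⟨ha, hle⟩
      obtain ⟨i, rfl⟩ : a ∈ Set.range (S.carrier.orderEmbOfFin rfl) := by
        rw [Finset.range_orderEmbOfFin]; exact ha
      exact ⟨i, (S.carrier.orderEmbOfFin rfl).le_iff_le.1 hle, rfl⟩
    · rintro ⟨i, hi, rfl⟩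
      exact ⟨Finset.orderEmbOfFin_mem _ _ _, (S.carrier.orderEmbOfFin rfl).monotone hi⟩
  rw [heq, Finset.card_map, Fin.card_Iic, S.elt_parity j]

theorem sup_filter_le_mod_two {N : ℕ} (S : FibonacciSet N) (i : ℕ) :
    ((S.carrier.filter (· ≤ i)).sup id) % 2 = (S.carrier.filter (· ≤ i)).card % 2 := by
  rcases (S.carrier.filter (· ≤ i)).eq_empty_or_nonempty with h0 | hne
  · simp [h0]
  · obtain ⟨s, hs, hsup⟩ := Finset.exists_mem_eq_sup _ hne id
    obtain ⟨hsS, hsi⟩ := Finset.mem_filter.1 hs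
    rw [hsup, id, ← S.card_filter_le_mod_two hsS]
    congr 2
    refine Finset.filter_congr fun a ha => ⟨fun h => h.trans hsi, fun h => ?_⟩
    have : id a ≤ (S.carrier.filter (· ≤ i)).sup id :=
      Finset.le_sup (f := id) (Finset.mem_filter.2 ⟨ha, h⟩)
    rwa [hsup] at this

/-- The largest element of S up to i has the parity of its rank in S, so the maximum may be replaced
by a count. This also covers the empty maximum 0. -/
theorem mem_freeSet_iff {N : ℕ} (S : FibonacciSet N) {i : ℕ} :
    i ∈ S.freeSet ↔ i ≤ N ∧ (i + (S.carrier.filter (· ≤ i)).card) % 2 = 1 := by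
  have hsup : (S.carrier.filter (· ≤ i)).sup id ≤ i :=
    Finset.sup_le fun s hs => (Finset.mem_filter.1 hs).2
  have hmod := S.sup_filter_le_mod_two i
  rw [freeSet, Finset.mem_filter, Finset.mem_Icc, Nat.odd_iff]
  constructor
  · rintro ⟨⟨-, h⟩, h'⟩
    omega
  · rintro ⟨h, h'⟩
    refine ⟨⟨?_, h⟩, by omega⟩
    by_contra! h0
    obtain rfl : i = 0 := by omega
    have : S.carrier.filter (· ≤ 0) = ∅ := by
      refine Finset.filter_eq_empty_iff.2 fun a ha => ?_
      have := (Finset.mem_Icc.1 (S.subset_Icc ha)).1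
      omega
    rw [this] at h'
    simp at h'

/-- Each position is a member of `S`, or the first or the second position of a free pair. -/
theorem indicator_add_indicator_freeSet {N : ℕ} (S : FibonacciSet N) {i : ℕ} (hi : i < N) :
    (if i + 1 ∈ S.carrier then 1 else 0) + (if i + 1 ∈ S.freeSet then 1 else 0) +
      (if i ∈ S.freeSet then 1 else 0) = 1 := by
  simp only [mem_freeSet_iff, Nat.succ_le_of_lt hi, hi.le, true_and]
  by_cases h : i + 1 ∈ S.carrier
  · have hf : S.carrier.filter (· ≤ i + 1) = insert (i + 1) (S.carrier.filter (· ≤ i)) := by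
      ext a
      simp only [Finset.mem_filter, Finset.mem_insert]
      constructor
      · rintro ⟨ha, hle⟩
        rcases hle.eq_or_lt with h | h
        · exact Or.inl h
        · exact Or.inr ⟨ha, by omega⟩
      · rintro (rfl | ⟨ha, hle⟩)
        · exact ⟨h, le_rfl⟩
        · exact ⟨ha, by omega⟩
    have hp := S.card_filter_le_mod_two h
    rw [hf, Finset.card_insert_of_notMem (by simp)] at hp ⊢
    rw [if_pos h, if_neg (by omega), if_neg (by omega)]
  · have hf : S.carrier.filter (· ≤ i + 1) = S.carrier.filter (· ≤ i) := by
      refine Finset.filter_congr fun s hs => ?_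
      have : s ≠ i + 1 := fun h' => h (h' ▸ hs)
      omega
    rw [hf, if_neg h]
    split_ifs <;> omega

theorem _root_.Finset.card_filter_le_eq_succ (A : Finset ℕ) (m : ℕ) :
    (A.filter (m ≤ ·)).card = (A.filter (m + 1 ≤ ·)).card + if m ∈ A then 1 else 0 := by
  have : A.filter (m ≤ ·) = A.filter (m + 1 ≤ ·) ∪ A.filter (m = ·) := by
    rw [← Finset.filter_or]
    exact Finset.filter_congr fun a _ => by omega
  rw [this, Finset.card_union_of_disjoint]
  · congr 1
    rw [Finset.filter_eq]
    split_ifs <;> simp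
  · exact Finset.disjoint_filter.2 fun a _ h h' => by omega

/-- Sum of `indicator_add_indicator_freeSet` over the positions m + 1, …, N. -/
theorem card_filter_add_card_freeSet_filter {N : ℕ} (S : FibonacciSet N) {m : ℕ} (hm : m ≤ N) :
    (S.carrier.filter (m + 1 ≤ ·)).card + (S.freeSet.filter (m + 1 ≤ ·)).card +
      (S.freeSet.filter (m ≤ ·)).card = N - m := by
  induction hm using Nat.decreasingInduction with
  | self =>
    have h1 : S.carrier.filter (N + 1 ≤ ·) = ∅ := Finset.filter_eq_empty_iff.2 fun a ha => by
      have := (Finset.mem_Icc.1 (S.subset_Icc ha)).2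
      omega
    have h2 : S.freeSet.filter (N + 1 ≤ ·) = ∅ := Finset.filter_eq_empty_iff.2 fun a ha => by
      have := mem_freeSet_lt ha
      omega
    have h3 : S.freeSet.filter (N ≤ ·) = ∅ := Finset.filter_eq_empty_iff.2 fun a ha => by
      have := mem_freeSet_lt ha
      omega
    rw [h1, h2, h3]
    simp
  | of_succ k hk ih =>
    have h1 := S.indicator_add_indicator_freeSet hk
    have h2 := S.carrier.card_filter_le_eq_succ (k + 1)
    have h3 := S.freeSet.card_filter_le_eq_succ (k + 1)
    have h4 := S.freeSet.card_filter_le_eq_succ k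
    omega

theorem dominatedBy_iff_card_freeSet_filter_le {N : ℕ} {S T : FibonacciSet N} :
    S.DominatedBy T ↔
      ∀ m, (T.freeSet.filter (m ≤ ·)).card ≤ (S.freeSet.filter (m ≤ ·)).card := by
  rw [dominatedBy_iff_card_filter_le]
  constructor
  · intro h m
    rcases le_or_gt m N with hm | hm
    · by_contra! hlt
      rcases Nat.eq_zero_or_pos m with rfl | hpos
      · have h1 := S.card_filter_add_card_freeSet_filter hm
        have h2 := T.card_filter_add_card_freeSet_filter hm
        have h3 := S.freeSet.card_filter_le_eq_succ 0
        have h4 := T.freeSet.card_filter_le_eq_succ 0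
        have h5 : 0 ∉ S.freeSet := fun h => by simpa using mem_freeSet_pos h
        have h6 : 0 ∉ T.freeSet := fun h => by simpa using mem_freeSet_pos h
        rw [if_neg h5] at h3
        rw [if_neg h6] at h4
        have := h (0 + 1)
        omega
      -- With s and f the numbers of elements ≥ k + 1 in the set and in its free set, s + 2f + [k
      -- free] = N - k. If f were larger for T, then 2f would grow by at least 2 and the indicator
      -- could offset only 1, so s would be smaller for T.
      · obtain ⟨k, rfl⟩ : ∃ k, m = k + 1 := ⟨m - 1, by omega⟩
        have h1 := S.card_filter_add_card_freeSet_filter (m := k) (by omega)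
        have h2 := T.card_filter_add_card_freeSet_filter (m := k) (by omega)
        have h3 := S.freeSet.card_filter_le_eq_succ k
        have h4 := T.freeSet.card_filter_le_eq_succ k
        have := h (k + 1)
        split_ifs at h3 h4 <;> omega
    · have : T.freeSet.filter (m ≤ ·) = ∅ := Finset.filter_eq_empty_iff.2 fun a ha => by
        have := mem_freeSet_lt ha
        omega
      simp [this]
  · intro h m
    rcases Nat.eq_zero_or_pos m with rfl | hpos
    · have h1 := S.card_filter_add_card_freeSet_filter (Nat.zero_le N)
      have h2 := T.card_filter_add_card_freeSet_filter (Nat.zero_le N)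
      have h3 := S.carrier.card_filter_le_eq_succ 0
      have h5 : 0 ∉ S.carrier := fun h => by simpa using S.subset_Icc h
      have h4 := T.carrier.card_filter_le_eq_succ 0
      have := h 0
      have := h (0 + 1)
      rw [if_neg h5] at h3
      omega
    · obtain ⟨k, rfl⟩ : ∃ k, m = k + 1 := ⟨m - 1, by omega⟩
      rcases le_or_gt k N with hk | hk
      · have h1 := S.card_filter_add_card_freeSet_filter hk
        have h2 := T.card_filter_add_card_freeSet_filter hk
        have := h k
        have := h (k + 1)
        omega
      · have : S.carrier.filter (k + 1 ≤ ·) = ∅ := Finset.filter_eq_empty_iff.2 fun a ha => by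
          have := (Finset.mem_Icc.1 (S.subset_Icc ha)).2
          omega
        rw [this]
        exact Nat.zero_le _

/-- The free set in decreasing order. -/
def freeList {N : ℕ} (S : FibonacciSet N) : List ℕ := S.freeSet.sort (· ≥ ·)

theorem mem_freeList {N : ℕ} {S : FibonacciSet N} {i : ℕ} : i ∈ S.freeList ↔ i ∈ S.freeSet :=
  Finset.mem_sort _

theorem pairwise_freeList {N : ℕ} (S : FibonacciSet N) :
    S.freeList.Pairwise fun a b => b + 2 ≤ a := by
  have h1 : S.freeList.Pairwise (· ≥ ·) := Finset.pairwise_sort _ _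
  have h2 : S.freeList.Nodup := Finset.sort_nodup _ _
  refine (h1.and h2).imp_of_mem fun {a b} ha hb hab => ?_
  have : a ≠ b + 1 := fun h => succ_notMem_freeSet (mem_freeList.1 hb) (h ▸ mem_freeList.1 ha)
  have := hab.1
  have := hab.2
  omega

theorem countP_freeList {N : ℕ} (S : FibonacciSet N) (m : ℕ) :
    S.freeList.countP (m ≤ ·) = (S.freeSet.filter (m ≤ ·)).card := by
  rw [Finset.card_def, Finset.filter_val, ← Multiset.countP_eq_card_filter,
    ← Finset.sort_eq S.freeSet (· ≥ ·), Multiset.coe_countP]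
  rfl

end FibonacciSet

/-! ### Raising generators: dominance implies inclusion of ideals -/

namespace OkadaAlgebra

variable {K : Type*} [Field K] {N : ℕ} (x y : ℕ → K)

/-- The generator `E_i`, extended by `1` to all indices. -/
noncomputable def genAt (i : ℕ) : OkadaAlgebra N x y :=
  if h : 1 ≤ i ∧ i < N then gen x y ⟨i, h⟩ else 1

theorem genAt_coe (i : OkadaIndex N) : genAt x y (i : ℕ) = gen x y i :=
  dif_pos i.2

theorem genAt_commute {i j : ℕ} (hij : i + 2 ≤ j ∨ j + 2 ≤ i) :
    Commute (genAt x y i : OkadaAlgebra N x y) (genAt x y j) := by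
  unfold genAt
  split_ifs with hi hj hj
  · exact gen_commute x y _ _ hij
  · exact Commute.one_right _
  · exact Commute.one_left _
  · exact Commute.one_left _

theorem gen_mul_self (i : OkadaIndex N) : gen x y i * gen x y i = x i • gen x y i := by
  have h := RingQuot.mkAlgHom_rel K (OkadaRel.sq (x := x) (y := y) i)
  simpa [gen] using h

theorem gen_contract (i j : OkadaIndex N) (hij : (j : ℕ) = i + 1) :
    gen x y j * gen x y i * gen x y j = y i • gen x y j := by
  have h := RingQuot.mkAlgHom_rel K (OkadaRel.contract (x := x) (y := y) i j hij)
  simpa [gen] using h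

theorem genAt_contract {i : ℕ} (hi : 1 ≤ i) (hi' : i + 2 ≤ N) :
    (genAt x y (i + 1) * genAt x y i * genAt x y (i + 1) : OkadaAlgebra N x y) =
      y i • genAt x y (i + 1) := by
  have h := gen_contract x y (N := N) ⟨i, hi, by omega⟩ ⟨i + 1, by omega, by omega⟩ rfl
  simpa only [← genAt_coe] using h

theorem freeElement_eq_prod (S : FibonacciSet N) :
    freeElement x y S = (S.freeList.map (genAt x y)).prod := by
  have hval : S.freeSet.attach.1.map (fun i => gen x y (freeIndex S i)) =
      ((S.freeList.map (genAt x y) : List (OkadaAlgebra N x y)) : Multiset _) := by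
    rw [← Multiset.map_coe, FibonacciSet.freeList, Finset.sort_eq,
      ← Multiset.attach_map_val' S.freeSet.1 (genAt x y)]
    exact Multiset.map_congr rfl fun i _ => (genAt_coe x y (freeIndex S i)).symm
  unfold freeElement Finset.noncommProd
  simp only [hval]
  exact Multiset.noncommProd_coe _ _

theorem commute_prod_genAt {i : ℕ} {l : List ℕ} (h : ∀ j ∈ l, i + 2 ≤ j ∨ j + 2 ≤ i) :
    Commute (genAt x y i : OkadaAlgebra N x y) (l.map (genAt x y)).prod := by
  refine Commute.list_prod_right _ _ fun a ha => ?_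
  obtain ⟨j, hj, rfl⟩ := List.mem_map.1 ha
  exact genAt_commute x y (h j hj)

/-- Induction on the factors f still to be raised towards g. B collects the factors already in
place; it commutes with every generator that the remaining moves use. -/
theorem mul_prod_genAt_mem_of_countP_le (hy : ∀ i, 1 ≤ i → i + 2 ≤ N → y i ≠ 0)
    (I : TwoSidedIdeal (OkadaAlgebra N x y)) (f : List ℕ) :
    ∀ (g : List ℕ) (B : OkadaAlgebra N x y),
      f.Pairwise (fun a b => b + 2 ≤ a) → g.Pairwise (fun a b => b + 2 ≤ a) →
      (∀ i ∈ f, 1 ≤ i) → (∀ i ∈ g, i < N) →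
      (∀ m : ℕ, f.countP (m ≤ ·) ≤ g.countP (m ≤ ·)) →
      (∀ b ∈ g, ∀ i ≤ b, Commute B (genAt x y i)) →
      B * (f.map (genAt x y)).prod ∈ I → B * (g.map (genAt x y)).prod ∈ I := by
  induction f with
  | nil =>
    intro g B _ _ _ _ _ _ h
    simp only [List.map_nil, List.prod_nil, mul_one] at h
    exact I.mul_mem_right _ _ h
  | cons a f ih =>
    intro g B hf hg hf1 hgN hcount hB h
    rw [List.pairwise_cons] at hf
    cases g with
    | nil => simpa using hcount 0
    | cons b g =>
      rw [List.pairwise_cons] at hg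
      have hab : a ≤ b := by
        have h1 := hcount a
        have h2 : 0 < (a :: f).countP (a ≤ ·) := List.countP_pos_iff.2 ⟨a, by simp, by simp⟩
        obtain ⟨c, hc, hac⟩ := List.countP_pos_iff.1 (h2.trans_le h1)
        have hac : a ≤ c := by simpa using hac
        rcases List.mem_cons.1 hc with rfl | hc
        · exact hac
        · have := hg.1 c hc
          omega
      -- Multiplying by E_{a+k+1} on both sides raises E_{a+k}: the outer factors pass through B and
      -- through the tail, whose indices are at most a - 2, and contract with E_{a+k}.
      have hshift : ∀ k, a + k ≤ b → B * (genAt x y (a + k) * (f.map (genAt x y)).prod) ∈ I := by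
        intro k
        induction k with
        | zero => intro _; simpa using h
        | succ k ihk =>
          intro hk
          have ha1 := hf1 a (by simp)
          have hbN := hgN b (by simp)
          have hy' : y (a + k) ≠ 0 := hy _ (by omega) (by omega)
          have hBc := hB b (by simp) (a + k + 1) hk
          have hfc : Commute (genAt x y (a + k + 1) : OkadaAlgebra N x y)
              (f.map (genAt x y)).prod :=
            commute_prod_genAt x y fun j hj => Or.inr (by have := hf.1 j hj; omega)
          have key : B * (genAt x y (a + k + 1) * (f.map (genAt x y)).prod) =
              algebraMap K _ (y (a + k))⁻¹ * (genAt x y (a + k + 1) *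
                (B * (genAt x y (a + k) * (f.map (genAt x y)).prod)) *
                  genAt x y (a + k + 1)) := by
            have hc := genAt_contract x y (N := N) (i := a + k) (by omega) (by omega)
            rw [← Algebra.smul_def, eq_inv_smul_iff₀ hy', ← mul_smul_comm, ← smul_mul_assoc, ← hc]
            simp only [mul_assoc]
            rw [hfc.eq, ← mul_assoc B, hBc.eq]
            simp only [mul_assoc]
          rw [← add_assoc, key]
          exact I.mul_mem_left _ _ (I.mul_mem_right _ _ (I.mul_mem_left _ _ (ihk (by omega))))
      have hlast := hshift (b - a) (by omega)
      rw [Nat.add_sub_cancel' hab, ← mul_assoc] at hlast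
      rw [List.map_cons, List.prod_cons, ← mul_assoc]
      refine ih g (B * genAt x y b) hf.2 hg.2 (fun i hi => hf1 i (by simp [hi]))
        (fun i hi => hgN i (by simp [hi])) (fun m => ?_) (fun c hc i hi => ?_) hlast
      · rcases le_or_gt m a with hm | hm
        · have := hcount m
          rw [List.countP_cons_of_pos (by simpa using hm),
            List.countP_cons_of_pos (by simpa using hm.trans hab)] at this
          omega
        · have : f.countP (m ≤ ·) = 0 := by
            rw [List.countP_eq_zero]
            intro c hc
            have := hf.1 c hc
            simp
            omega
          omega
      · have := hg.1 c hc
        exact (hB b (by simp) i (by omega)).mul_left (genAt_commute x y (Or.inr (by omega)))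

theorem freeIdeal_le_of_dominatedBy (hy : ∀ i, 1 ≤ i → i + 2 ≤ N → y i ≠ 0)
    {S T : FibonacciSet N} (h : S.DominatedBy T) : freeIdeal x y S ≤ freeIdeal x y T := by
  refine TwoSidedIdeal.span_le.2 (Set.singleton_subset_iff.2 ?_)
  rw [FibonacciSet.dominatedBy_iff_card_freeSet_filter_le] at h
  have hT : freeElement x y T ∈ freeIdeal x y T := TwoSidedIdeal.subset_span rfl
  rw [freeElement_eq_prod, ← one_mul (List.prod _)] at hT
  rw [freeElement_eq_prod, ← one_mul (List.prod _)]
  refine mul_prod_genAt_mem_of_countP_le x y hy _ _ _ 1 T.pairwise_freeList S.pairwise_freeList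
    (fun i hi => FibonacciSet.mem_freeSet_pos (FibonacciSet.mem_freeList.1 hi))
    (fun i hi => FibonacciSet.mem_freeSet_lt (FibonacciSet.mem_freeList.1 hi))
    (fun m => ?_) (fun _ _ _ _ => Commute.one_left _) hT
  simpa only [FibonacciSet.countP_freeList] using h m

/-- The homomorphism out of the Okada algebra given by elements satisfying its relations. -/
noncomputable def lift {A : Type*} [Ring A] [Algebra K A] (e : OkadaIndex N → A)
    (hsq : ∀ i, e i * e i = x i • e i)
    (hcomm : ∀ i j : OkadaIndex N, (i : ℕ) + 2 ≤ j → Commute (e i) (e j))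
    (hcontract : ∀ i j : OkadaIndex N, (j : ℕ) = i + 1 → e j * e i * e j = y i • e j) :
    OkadaAlgebra N x y →ₐ[K] A :=
  RingQuot.liftAlgHom K ⟨FreeAlgebra.lift K e, by
    intro a b hab
    cases hab with
    | sq i => simpa using hsq i
    | comm i j hij =>
      rcases hij with hij | hij
      · simpa using (hcomm i j hij).eq
      · simpa using (hcomm j i hij).eq.symm
    | contract i j hij => simpa using hcontract i j hij⟩

theorem lift_gen {A : Type*} [Ring A] [Algebra K A] (e : OkadaIndex N → A)
    (hsq : ∀ i, e i * e i = x i • e i)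
    (hcomm : ∀ i j : OkadaIndex N, (i : ℕ) + 2 ≤ j → Commute (e i) (e j))
    (hcontract : ∀ i j : OkadaIndex N, (j : ℕ) = i + 1 → e j * e i * e j = y i • e j) (i : OkadaIndex N) :
    lift x y e hsq hcomm hcontract (gen x y i) = e i := by
  simp [lift, gen]

end OkadaAlgebra

/-! ### Induced modules and the nonvanishing of free elements -/

/-- A family of elements indexed by `ℕ` that satisfies the Okada relations for all indices. -/
structure IsOkadaFamily {K : Type*} [Field K] (x y : ℕ → K) {A : Type*} [Ring A] [Algebra K A]
    (e : ℕ → A) : Prop where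
  sq : ∀ i, e i * e i = x i • e i
  comm : ∀ i j, i + 2 ≤ j → e i * e j = e j * e i
  contract : ∀ i, e (i + 1) * e i * e (i + 1) = y i • e (i + 1)

namespace IsOkadaFamily

variable {K : Type*} [Field K] {x y : ℕ → K} {U : Type*} [AddCommGroup U] [Module K U]
  {e : ℕ → Module.End K U}

/-- The increasing product `e j * e (j + 1) * ⋯ * e (k - 1)`. -/
def ascProd (e : ℕ → Module.End K U) (j k : ℕ) : Module.End K U :=
  ((List.range' j (k - j)).map e).prod

theorem ascProd_self (e : ℕ → Module.End K U) (j : ℕ) : ascProd e j j = 1 := by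
  simp [ascProd]

theorem ascProd_eq_mul (e : ℕ → Module.End K U) {j k : ℕ} (h : j < k) :
    ascProd e j k = e j * ascProd e (j + 1) k := by
  have : k - j = (k - (j + 1)) + 1 := by omega
  rw [ascProd, this, List.range'_succ, List.map_cons, List.prod_cons, ascProd]

theorem ascProd_mul_ascProd (e : ℕ → Module.End K U) {j k l : ℕ} (h : j ≤ k) (h' : k ≤ l) :
    ascProd e j k * ascProd e k l = ascProd e j l := by
  induction h using Nat.decreasingInduction with
  | self => rw [ascProd_self, one_mul]
  | of_succ i hi ih => rw [ascProd_eq_mul e hi, mul_assoc, ih, ← ascProd_eq_mul e (by omega)]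

theorem commute_ascProd (he : IsOkadaFamily x y e) {i j k : ℕ} (h : i + 2 ≤ j ∨ k < i) :
    Commute (e i) (ascProd e j k) := by
  refine Commute.list_prod_right _ _ fun a ha => ?_
  obtain ⟨l, hl, rfl⟩ := List.mem_map.1 ha
  rw [List.mem_range'_1] at hl
  rcases h with h | h
  · exact he.comm i l (by omega)
  · exact (he.comm l i (by omega)).symm

theorem ascProd_commute_ascProd (he : IsOkadaFamily x y e) {i j k l : ℕ} (h : j < k) :
    Commute (ascProd e i j) (ascProd e k l) := by
  refine Commute.list_prod_left _ _ fun a ha => ?_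
  obtain ⟨m, hm, rfl⟩ := List.mem_map.1 ha
  rw [List.mem_range'_1] at hm
  exact he.commute_ascProd (Or.inl (by omega))

/-- The coefficient `q` in `e i * (c j * u) = c i * (q * u)` for `j ≤ i + 1`. -/
def inducedCoeff (x y : ℕ → K) (e : ℕ → Module.End K U) (i j : ℕ) : Module.End K U :=
  if i + 1 = j then 1 else if i = j then x i • 1 else y (i - 1) • ascProd e j (i - 1)

/-- The action of `e i` on the induced module, which is spanned by the formal products
`c j * u` with `c j = e j * e (j + 1) * ⋯` and `u` in `U`. -/
noncomputable def induced (x y : ℕ → K) (e : ℕ → Module.End K U) (i : ℕ) :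
    Module.End K (ℕ →₀ U) :=
  Finsupp.lsum K fun j =>
    if i + 1 < j then Finsupp.lsingle j ∘ₗ e i
    else Finsupp.lsingle i ∘ₗ inducedCoeff x y e i j

theorem induced_single_of_lt {i j : ℕ} (h : i + 1 < j) (u : U) :
    induced x y e i (Finsupp.single j u) = Finsupp.single j (e i u) := by
  simp [induced, h]

theorem induced_single_of_le {i j : ℕ} (h : j ≤ i + 1) (u : U) :
    induced x y e i (Finsupp.single j u) = Finsupp.single i (inducedCoeff x y e i j u) := by
  simp [induced, Nat.not_lt.2 h]

theorem inducedCoeff_succ_right (i : ℕ) : inducedCoeff x y e i (i + 1) = 1 := if_pos rfl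

theorem inducedCoeff_self (i : ℕ) : inducedCoeff x y e i i = x i • 1 := by
  simp [inducedCoeff]

/-- The value is dictated by e_i c_j = e_j ⋯ e_{i-2} (e_i e_{i-1} e_i) c_{i+1} = y_{i-1} e_j ⋯
e_{i-2} c_i, where e_j, …, e_{i-2} then commute past c_i. -/
theorem inducedCoeff_of_lt {i j : ℕ} (h : j < i) :
    inducedCoeff x y e i j = y (i - 1) • ascProd e j (i - 1) := by
  rw [inducedCoeff, if_neg (by omega), if_neg (by omega)]

theorem inducedCoeff_succ_left (i : ℕ) : inducedCoeff x y e (i + 1) i = y i • 1 := by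
  rw [inducedCoeff_of_lt (Nat.lt_succ_self i), Nat.succ_sub_one, ascProd_self]

/-- This is the commutation of e_i and e_k on c_j u in the only case where both change the index. -/
theorem mul_inducedCoeff (he : IsOkadaFamily x y e) {i j k : ℕ} (hik : i + 2 ≤ k)
    (hj : j ≤ i + 1) :
    e i * inducedCoeff x y e k j = inducedCoeff x y e k i * inducedCoeff x y e i j := by
  rw [inducedCoeff_of_lt (by omega : j < k), inducedCoeff_of_lt (by omega : i < k),
    mul_smul_comm, smul_mul_assoc]
  congr 1
  rcases hj.eq_or_lt with rfl | hj
  · rw [inducedCoeff_succ_right, mul_one, ← ascProd_eq_mul e (by omega)]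
  · rcases (Nat.lt_succ_iff.1 hj).eq_or_lt with rfl | hj
    · rw [inducedCoeff_self, ascProd_eq_mul e (by omega : j < k - 1), ← mul_assoc, he.sq]
      simp
    -- After the shift of i, e_{i+1} moves right past e_j ⋯ e_{i-1} and contracts with e_i e_{i+1}.
    -- This removes e_i, and the two blocks left on either side of the gap commute.
    · obtain ⟨i, rfl⟩ : ∃ l, i = l + 1 := ⟨i - 1, by omega⟩
      rw [inducedCoeff_of_lt hj, Nat.add_sub_cancel,
        ← ascProd_mul_ascProd e (by omega : j ≤ i) (by omega : i ≤ k - 1),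
        ascProd_eq_mul e (by omega : i < k - 1), ascProd_eq_mul e (by omega : i + 1 < k - 1),
        ← mul_assoc, (he.commute_ascProd (Or.inr (by omega))).eq, mul_assoc, ← mul_assoc (e i),
        ← mul_assoc (e (i + 1)), ← mul_assoc (e (i + 1)), he.contract, smul_mul_assoc,
        ← ascProd_eq_mul e (by omega), mul_smul_comm, mul_smul_comm,
        (he.ascProd_commute_ascProd (by omega)).eq]

theorem induced_isOkadaFamily (he : IsOkadaFamily x y e) :
    IsOkadaFamily x y (induced x y e) where
  sq i := by
    refine Finsupp.lhom_ext fun j u => ?_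
    simp only [Module.End.mul_apply, LinearMap.smul_apply]
    rcases lt_or_ge (i + 1) j with hj | hj
    · rw [induced_single_of_lt hj, induced_single_of_lt hj, ← Module.End.mul_apply, he.sq]
      simp
    · rw [induced_single_of_le hj, induced_single_of_le (by omega), inducedCoeff_self]
      simp
  comm i k hik := by
    refine Finsupp.lhom_ext fun j u => ?_
    simp only [Module.End.mul_apply]
    rcases lt_or_ge (k + 1) j with hk | hk
    · rw [induced_single_of_lt hk, induced_single_of_lt (by omega), induced_single_of_lt (by omega),
        induced_single_of_lt hk, ← Module.End.mul_apply, ← Module.End.mul_apply, he.comm i k hik]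
    · rw [induced_single_of_le hk, induced_single_of_lt (by omega)]
      rcases lt_or_ge (i + 1) j with hj | hj
      · rw [induced_single_of_lt hj, induced_single_of_le hk, ← Module.End.mul_apply,
          ← Module.End.mul_apply]
        congr 2
        unfold inducedCoeff
        split_ifs
        · simp
        · simp
        · rw [mul_smul_comm, smul_mul_assoc, (he.commute_ascProd (Or.inl (by omega))).eq]
      · rw [induced_single_of_le hj, induced_single_of_le (by omega), ← Module.End.mul_apply,
          ← Module.End.mul_apply, he.mul_inducedCoeff hik hj]
  contract i := by
    refine Finsupp.lhom_ext fun j u => ?_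
    simp only [Module.End.mul_apply, LinearMap.smul_apply]
    rcases lt_or_ge (i + 1 + 1) j with hj | hj
    · rw [induced_single_of_lt hj, induced_single_of_lt (by omega), induced_single_of_lt hj,
        ← Module.End.mul_apply, ← Module.End.mul_apply, he.contract]
      simp
    · rw [induced_single_of_le hj, induced_single_of_le le_rfl, induced_single_of_le (by omega),
        inducedCoeff_succ_right, inducedCoeff_succ_left]
      simp

theorem prod_induced_single {n : ℕ} {l : List ℕ} (h : ∀ i ∈ l, i + 1 < n) (u : U) :
    (l.map (induced x y e)).prod (Finsupp.single n u) =
      Finsupp.single n ((l.map e).prod u) := by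
  induction l with
  | nil => simp
  | cons a l ih =>
    rw [List.map_cons, List.prod_cons, Module.End.mul_apply,
      ih fun i hi => h i (List.mem_cons_of_mem _ hi), induced_single_of_lt (h a (by simp)),
      List.map_cons, List.prod_cons, Module.End.mul_apply]

theorem zero (x y : ℕ → K) : IsOkadaFamily x y (fun _ => (0 : Module.End K U)) :=
  ⟨by simp, by simp, by simp⟩

end IsOkadaFamily

-- Passing to the induced module gains one index. On the vectors c_{n+1} u, products of e_i with i <
-- n act as they do on U, and e_n sends c_{n+1} u to c_n u without loss. By the gap condition e_n
-- can only be the first factor, hence the last to act.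
universe u in
theorem exists_isOkadaFamily_prod_ne_zero {K : Type u} [Field K] (x y : ℕ → K) (n : ℕ) :
    ∃ (U : Type u) (_ : AddCommGroup U) (_ : Module K U) (e : ℕ → Module.End K U),
      IsOkadaFamily x y e ∧ ∀ l : List ℕ, l.Pairwise (fun a b => b + 2 ≤ a) →
        (∀ i ∈ l, i < n) → (l.map e).prod ≠ 0 := by
  induction n with
  | zero =>
    refine ⟨K, inferInstance, inferInstance, fun _ => 0, IsOkadaFamily.zero x y, ?_⟩
    intro l _ hl
    cases l with
    | nil => simp
    | cons a l => simpa using hl a (by simp)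
  | succ n ih =>
    obtain ⟨U, _, _, e, he, hne⟩ := ih
    refine ⟨ℕ →₀ U, inferInstance, inferInstance, IsOkadaFamily.induced x y e,
      he.induced_isOkadaFamily, ?_⟩
    intro l hl hln h0
    have hcases : (∃ m, l = n :: m) ∨ ∀ i ∈ l, i < n := by
      cases l with
      | nil => simp
      | cons a m =>
        rw [List.pairwise_cons] at hl
        have ha := hln a (by simp)
        rcases eq_or_ne a n with rfl | hne
        · exact Or.inl ⟨m, rfl⟩
        · refine Or.inr fun i hi => ?_
          rcases List.mem_cons.1 hi with rfl | hi
          · omega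
          · have := hl.1 i hi
            omega
    rcases hcases with ⟨m, rfl⟩ | hlt
    · rw [List.pairwise_cons] at hl
      have hm : ∀ i ∈ m, i + 2 ≤ n := hl.1
      refine hne m hl.2 (fun i hi => by have := hm i hi; omega) ?_
      ext u
      have h1 := congr($h0 (Finsupp.single (n + 1) u))
      rw [List.map_cons, List.prod_cons, Module.End.mul_apply,
        IsOkadaFamily.prod_induced_single fun i hi => by have := hm i hi; omega,
        IsOkadaFamily.induced_single_of_le le_rfl,
        IsOkadaFamily.inducedCoeff_succ_right] at h1
      simpa using h1
    · refine hne l hl hlt ?_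
      ext u
      have h1 := congr($h0 (Finsupp.single (n + 1) u))
      rw [IsOkadaFamily.prod_induced_single fun i hi => Nat.succ_lt_succ (hlt i hi)] at h1
      simpa using h1

theorem OkadaAlgebra.freeElement_ne_zero {K : Type*} [Field K] {N : ℕ} (x y : ℕ → K)
    (S : FibonacciSet N) : OkadaAlgebra.freeElement x y S ≠ 0 := by
  intro h0
  obtain ⟨U, _, _, e, he, hne⟩ := exists_isOkadaFamily_prod_ne_zero x y N
  refine hne S.freeList S.pairwise_freeList
    (fun i hi => FibonacciSet.mem_freeSet_lt (FibonacciSet.mem_freeList.1 hi)) ?_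
  let φ : OkadaAlgebra N x y →ₐ[K] Module.End K U :=
    OkadaAlgebra.lift x y (fun i => e i) (fun i => he.sq i) (fun i j hij => he.comm i j hij)
      (fun i j hij => by rw [hij]; exact he.contract i)
  have h1 : φ (OkadaAlgebra.freeElement x y S) = 0 := by rw [h0, map_zero]
  rw [OkadaAlgebra.freeElement_eq_prod, map_list_prod, List.map_map] at h1
  rw [← h1]
  congr 1
  refine List.map_congr_left fun i hi => ?_
  have hi := FibonacciSet.mem_freeList.1 hi
  have hiN : 1 ≤ i ∧ i < N := ⟨FibonacciSet.mem_freeSet_pos hi, FibonacciSet.mem_freeSet_lt hi⟩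
  rw [Function.comp_apply, OkadaAlgebra.genAt, dif_pos hiN]
  exact (OkadaAlgebra.lift_gen x y (fun i : OkadaIndex N => e i) _ _ _ ⟨i, hiN⟩).symm

/-! ### Reduction of subspaces along isotropic vectors -/

namespace LinearMap.BilinForm

variable {F V : Type*} [Field F] [AddCommGroup V] [Module F V] (B : LinearMap.BilinForm F V)

/-- The reduction of `W` along `v`: the part of `W` orthogonal to `v`, together with `v`. -/
def reduce (v : V) (W : Submodule F V) : Submodule F V :=
  W ⊓ LinearMap.ker (B v) ⊔ Submodule.span F {v}

variable {B}

theorem mem_reduce {v w : V} {W : Submodule F V} :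
    w ∈ B.reduce v W ↔ ∃ a ∈ W, B v a = 0 ∧ ∃ c : F, a + c • v = w := by
  simp only [reduce, Submodule.mem_sup, Submodule.mem_inf, LinearMap.mem_ker,
    Submodule.mem_span_singleton]
  constructor
  · rintro ⟨a, ⟨ha, hva⟩, _, ⟨c, rfl⟩, h⟩
    exact ⟨a, ha, hva, c, h⟩
  · rintro ⟨a, ha, hva, c, h⟩
    exact ⟨a, ⟨ha, hva⟩, _, ⟨c, rfl⟩, h⟩

theorem mem_reduce_self (v : V) (W : Submodule F V) : v ∈ B.reduce v W :=
  le_sup_right (a := W ⊓ LinearMap.ker (B v)) (Submodule.mem_span_singleton_self v)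

theorem mem_reduce_of_mem {v w : V} {W : Submodule F V} (hw : w ∈ W) (h : B v w = 0) :
    w ∈ B.reduce v W :=
  le_sup_left (b := Submodule.span F {v}) ⟨hw, h⟩

theorem reduce_le (v : V) (W : Submodule F V) : B.reduce v W ≤ W ⊔ Submodule.span F {v} :=
  sup_le_sup_right inf_le_left _

theorem apply_eq_zero_of_mem_reduce {v w : V} {W : Submodule F V} (hv : B v v = 0)
    (hw : w ∈ B.reduce v W) : B v w = 0 := by
  obtain ⟨a, -, ha, c, rfl⟩ := mem_reduce.1 hw
  simp [ha, hv]

theorem reduce_reduce {v : V} (hv : B v v = 0) (W : Submodule F V) :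
    B.reduce v (B.reduce v W) = B.reduce v W := by
  refine le_antisymm (sup_le inf_le_left ?_) fun w hw =>
    mem_reduce_of_mem hw (apply_eq_zero_of_mem_reduce hv hw)
  rw [Submodule.span_singleton_le_iff_mem]
  exact mem_reduce_self v W

theorem reduce_comm_le {v w : V} (hvw : B v w = 0) (hwv : B w v = 0) (W : Submodule F V) :
    B.reduce v (B.reduce w W) ≤ B.reduce w (B.reduce v W) := by
  intro u hu
  obtain ⟨a', ha', hva', c, rfl⟩ := mem_reduce.1 hu
  obtain ⟨a, ha, hwa, d, rfl⟩ := mem_reduce.1 ha'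
  have hva : B v a = 0 := by simpa [hvw] using hva'
  refine mem_reduce.2 ⟨a + c • v, mem_reduce.2 ⟨a, ha, hva, c, rfl⟩, by simp [hwa, hwv], d, ?_⟩
  abel

theorem reduce_comm {v w : V} (hvw : B v w = 0) (hwv : B w v = 0) (W : Submodule F V) :
    B.reduce v (B.reduce w W) = B.reduce w (B.reduce v W) :=
  (reduce_comm_le hvw hwv W).antisymm (reduce_comm_le hwv hvw W)

/-- If b is orthogonal to v, then b + d w is orthogonal to v only for d = 0, so w cannot survive the
second reduction along v. Conversely, a multiple of v makes any vector of the reduction orthogonal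
to w, and the last reduction restores that multiple. -/
theorem reduce_contract {v w : V} (hv : B v v = 0) (hvw : B v w ≠ 0) (hwv : B w v ≠ 0)
    (W : Submodule F V) : B.reduce v (B.reduce w (B.reduce v W)) = B.reduce v W := by
  apply le_antisymm
  · intro u hu
    obtain ⟨a, ha, hva, c, rfl⟩ := mem_reduce.1 hu
    obtain ⟨b, hb, hwb, d, rfl⟩ := mem_reduce.1 ha
    have hvb := apply_eq_zero_of_mem_reduce hv hb
    have hd : d = 0 := by simpa [hvb, hvw] using hva
    rw [hd, zero_smul, add_zero]
    exact add_mem hb (Submodule.smul_mem _ _ (mem_reduce_self v W))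
  · intro u hu
    have hvu := apply_eq_zero_of_mem_reduce hv hu
    refine mem_reduce.2 ⟨u - (B w u / B w v) • v, mem_reduce_of_mem
      (sub_mem hu (Submodule.smul_mem _ _ (mem_reduce_self v W))) ?_, by simp [hvu, hv],
      B w u / B w v, by abel⟩
    simp [hwv]

/-- `W` is totally isotropic. -/
def IsIsotropic (B : LinearMap.BilinForm F V) (W : Submodule F V) : Prop :=
  ∀ a ∈ W, ∀ b ∈ W, B a b = 0

theorem IsIsotropic.reduce {v : V} {W : Submodule F V} (hB : B.IsSymm) (hv : B v v = 0)
    (hW : B.IsIsotropic W) : B.IsIsotropic (B.reduce v W) := by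
  intro a' ha' b' hb'
  obtain ⟨a, ha, hva, c, rfl⟩ := mem_reduce.1 ha'
  obtain ⟨b, hb, hvb, d, rfl⟩ := mem_reduce.1 hb'
  have hav : B a v = 0 := by rw [hB.eq, hva]
  simp [hW a ha b hb, hvb, hav, hv]

/-- Intersecting with v^⊥ costs at most one dimension. If it costs one, then v ∉ W by isotropy, and
adding v regains it. -/
theorem IsIsotropic.finrank_le_finrank_reduce [FiniteDimensional F V] {v : V}
    {W : Submodule F V} (hW : B.IsIsotropic W) :
    Module.finrank F W ≤ Module.finrank F (B.reduce v W) := by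
  by_cases h : W ≤ LinearMap.ker (B v)
  · exact Submodule.finrank_mono fun w hw => mem_reduce_of_mem hw (h hw)
  · have hvW : v ∉ W := fun hv => h fun w hw => hW v hv w hw
    have hlt : W ⊓ LinearMap.ker (B v) < B.reduce v W := by
      refine lt_of_le_of_ne le_sup_left fun he => hvW ?_
      have := mem_reduce_self (B := B) v W
      rw [← he] at this
      exact this.1
    have h1 := Submodule.finrank_lt_finrank_of_lt hlt
    have h2 := Submodule.finrank_sup_add_finrank_inf_eq W (LinearMap.ker (B v))
    have h3 := Submodule.finrank_le (W ⊔ LinearMap.ker (B v))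
    have h4 := (B v).finrank_range_add_finrank_ker
    have h5 := Submodule.finrank_le (LinearMap.range (B v))
    rw [Module.finrank_self] at h5
    omega

end LinearMap.BilinForm

/-! ### The monoid of reductions for the path form -/

namespace PathForm

/-- The adjacency form of the path on `0, …, N - 1`. -/
noncomputable def form (N : ℕ) : LinearMap.BilinForm ℚ (Fin N → ℚ) :=
  Matrix.toBilin' (Matrix.of fun i j : Fin N =>
    if (i : ℕ) + 1 = j ∨ (j : ℕ) + 1 = i then (1 : ℚ) else 0)

/-- The `i`-th standard basis vector, or `0` if `i` is out of range. -/
def vec (N i : ℕ) : Fin N → ℚ := if h : i < N then Pi.single ⟨i, h⟩ 1 else 0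

theorem form_vec {N i j : ℕ} (hi : i < N) (hj : j < N) :
    form N (vec N i) (vec N j) = if i + 1 = j ∨ j + 1 = i then 1 else 0 := by
  simp [form, vec, hi, hj, Matrix.toBilin'_single]

theorem form_vec_eq_zero {N i j : ℕ} (h : i + 1 ≠ j) (h' : j + 1 ≠ i) :
    form N (vec N i) (vec N j) = 0 := by
  by_cases hi : i < N
  · by_cases hj : j < N
    · rw [form_vec hi hj, if_neg (by tauto)]
    · simp [vec, hj]
  · simp [vec, hi]

theorem form_isSymm (N : ℕ) : (form N).IsSymm := by
  rw [form, Matrix.isSymm_toBilin'_iff_isSymm]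
  refine Matrix.IsSymm.ext fun i j => ?_
  simp only [Matrix.of_apply, or_comm]

/-- The isotropic subspaces for the adjacency form of the path. -/
abbrev IsotropicSubspace (N : ℕ) : Type :=
  {W : Submodule ℚ (Fin N → ℚ) // (form N).IsIsotropic W}

/-- The transformations of isotropic subspaces that do not lower the dimension. -/
def inflating (N : ℕ) : Submonoid (Function.End (IsotropicSubspace N)) where
  carrier := {f | ∀ W, Module.finrank ℚ W.1 ≤ Module.finrank ℚ (f W).1}
  mul_mem' {_ g} hf hg W := (hg W).trans (hf (g W))
  one_mem' _ := le_rfl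

/-- Reduction along the `i`-th basis vector if `m ≤ i`, and the identity otherwise. -/
noncomputable def step (N m i : ℕ) : inflating N :=
  if m ≤ i then
    ⟨fun W => ⟨(form N).reduce (vec N i) W.1,
      W.2.reduce (form_isSymm N) (form_vec_eq_zero (by omega) (by omega))⟩,
      fun W => W.2.finrank_le_finrank_reduce⟩
  else 1

theorem step_apply_of_le {N m i : ℕ} (h : m ≤ i) (W : IsotropicSubspace N) :
    ((step N m i).1 W).1 = (form N).reduce (vec N i) W.1 := by
  simp [step, h]

theorem step_of_lt {N m i : ℕ} (h : i < m) : step N m i = 1 := if_neg (by omega)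

theorem inflating_ext {N : ℕ} {f g : inflating N} (h : ∀ W, (f.1 W).1 = (g.1 W).1) : f = g :=
  Subtype.ext (funext fun W => Subtype.ext (h W))

theorem mul_apply {N : ℕ} (f g : inflating N) (W : IsotropicSubspace N) :
    (f * g).1 W = f.1 (g.1 W) := rfl

theorem step_mul_self (N m i : ℕ) : step N m i * step N m i = step N m i := by
  rcases le_or_gt m i with h | h
  · refine inflating_ext fun W => ?_
    simp only [mul_apply, step_apply_of_le h]
    exact LinearMap.BilinForm.reduce_reduce (form_vec_eq_zero (by omega) (by omega)) _
  · rw [step_of_lt h, one_mul]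

theorem step_comm (N m : ℕ) {i j : ℕ} (hij : i + 2 ≤ j) :
    step N m i * step N m j = step N m j * step N m i := by
  rcases le_or_gt m i with h | h
  · refine inflating_ext fun W => ?_
    simp only [mul_apply, step_apply_of_le h, step_apply_of_le (by omega : m ≤ j)]
    exact LinearMap.BilinForm.reduce_comm (form_vec_eq_zero (by omega) (by omega))
      (form_vec_eq_zero (by omega) (by omega)) _
  · rw [step_of_lt h, one_mul, mul_one]

theorem step_contract (N m : ℕ) {i : ℕ} (hi : i + 1 < N) :
    step N m (i + 1) * step N m i * step N m (i + 1) = step N m (i + 1) := by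
  rcases le_or_gt m i with h | h
  · refine inflating_ext fun W => ?_
    simp only [mul_apply, step_apply_of_le h, step_apply_of_le (by omega : m ≤ i + 1)]
    refine LinearMap.BilinForm.reduce_contract (form_vec_eq_zero (by omega) (by omega)) ?_ ?_ _
    · rw [form_vec hi (by omega), if_pos (Or.inr rfl)]
      exact one_ne_zero
    · rw [form_vec (by omega) hi, if_pos (Or.inl rfl)]
      exact one_ne_zero
  -- Below the cutoff the middle factor is 1, and the contraction becomes idempotence.
  · rw [step_of_lt h, mul_one, step_mul_self]

/-- Each reduction inserts its own basis vector; the later ones keep it, as indices at distance at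
least 2 give orthogonal vectors. -/
theorem vec_mem_prod_step {N m : ℕ} {l : List ℕ} (hl : l.Pairwise fun a b => b + 2 ≤ a)
    (W : IsotropicSubspace N) {i : ℕ} (hi : i ∈ l) (hm : m ≤ i) :
    vec N i ∈ (((l.map (step N m)).prod).1 W).1 := by
  induction l with
  | nil => simp at hi
  | cons a l ih =>
    rw [List.pairwise_cons] at hl
    rw [List.map_cons, List.prod_cons, mul_apply]
    rcases List.mem_cons.1 hi with rfl | hi
    · rw [step_apply_of_le hm]
      exact LinearMap.BilinForm.mem_reduce_self _ _
    · have := hl.1 i hi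
      rw [step_apply_of_le (by omega)]
      exact LinearMap.BilinForm.mem_reduce_of_mem (ih hl.2 hi)
        (form_vec_eq_zero (by omega) (by omega))

/-- The zero subspace. -/
def bot (N : ℕ) : IsotropicSubspace N :=
  ⟨⊥, fun a ha b _ => by rw [(Submodule.mem_bot ℚ).1 ha]; simp⟩

theorem prod_step_bot_le {N m : ℕ} (l : List ℕ) :
    (((l.map (step N m)).prod).1 (bot N)).1 ≤
      Submodule.span ℚ (vec N '' {i | i ∈ l ∧ m ≤ i}) := by
  induction l with
  | nil => exact bot_le
  | cons a l ih =>
    rw [List.map_cons, List.prod_cons, mul_apply]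
    have hsub : Submodule.span ℚ (vec N '' {i | i ∈ l ∧ m ≤ i}) ≤
        Submodule.span ℚ (vec N '' {i | i ∈ a :: l ∧ m ≤ i}) :=
      Submodule.span_mono (Set.image_mono fun i hi => ⟨List.mem_cons_of_mem _ hi.1, hi.2⟩)
    rcases le_or_gt m a with h | h
    · rw [step_apply_of_le h]
      refine (LinearMap.BilinForm.reduce_le _ _).trans (sup_le (ih.trans hsub) ?_)
      rw [Submodule.span_singleton_le_iff_mem]
      exact Submodule.subset_span ⟨a, ⟨by simp, h⟩, rfl⟩
    · rw [step_of_lt h]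
      exact ih.trans hsub

theorem finrank_span_vec {N : ℕ} {s : Finset ℕ} (hs : ∀ i ∈ s, i < N) :
    Module.finrank ℚ (Submodule.span ℚ (vec N '' (s : Set ℕ))) = s.card := by
  have hli : LinearIndependent ℚ fun i : s => vec N i := by
    have h1 := (Pi.basisFun ℚ (Fin N)).linearIndependent.comp
      (fun i : s => (⟨i, hs i i.2⟩ : Fin N)) fun i j hij => Subtype.ext (by simpa using hij)
    convert h1 using 2 with i
    simp [vec, hs i i.2]
  have h2 := finrank_span_eq_card hli
  rw [Fintype.card_coe] at h2
  rw [← h2, Set.image_eq_range]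
  rfl

theorem card_filter_le_of_prod_step_eq {N m : ℕ} {S T : FibonacciSet N} {u w : inflating N}
    (h : (S.freeList.map (step N m)).prod = u * (T.freeList.map (step N m)).prod * w) :
    (T.freeSet.filter (m ≤ ·)).card ≤ (S.freeSet.filter (m ≤ ·)).card := by
  have hlt (R : FibonacciSet N) : ∀ i ∈ R.freeSet.filter (m ≤ ·), i < N := fun i hi =>
    FibonacciSet.mem_freeSet_lt (Finset.mem_filter.1 hi).1
  have hS := Submodule.finrank_mono (prod_step_bot_le (N := N) (m := m) S.freeList)
  have hset : {i | i ∈ S.freeList ∧ m ≤ i} = (S.freeSet.filter (m ≤ ·) : Finset ℕ) := by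
    ext i
    simp [FibonacciSet.mem_freeList]
  rw [hset, finrank_span_vec (hlt S), h, mul_apply, mul_apply] at hS
  rw [← finrank_span_vec (hlt T)]
  -- u does not lower the dimension, and w only replaces 0 by another isotropic subspace, to which
  -- the product for T still adds all its vectors.
  refine le_trans ?_ ((u.2 _).trans hS)
  refine Submodule.finrank_mono (Submodule.span_le.2 ?_)
  rintro _ ⟨i, hi, rfl⟩
  obtain ⟨hi, hm⟩ := Finset.mem_filter.1 hi
  exact vec_mem_prod_step T.pairwise_freeList _ (FibonacciSet.mem_freeList.2 hi) hm

end PathForm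

/-! ### Monoid gradings: inclusion of ideals implies dominance -/

namespace OkadaAlgebra

variable {K : Type*} [Field K] {N : ℕ} (x y : ℕ → K)

/-- The two-sided ideal of elements supported in `M * t * M`. -/
noncomputable def supportIdeal (R : Type*) [Ring R] {M : Type*} [Monoid M] (t : M) :
    TwoSidedIdeal (MonoidAlgebra R M) :=
  .mk' {a | ∀ m, a.coeff m ≠ 0 → ∃ u w, m = u * t * w}
    (by simp)
    (fun {a b} ha hb m hm => by
      by_cases h : a.coeff m = 0
      · exact hb m (by simpa [h] using hm)
      · exact ha m h)
    (fun {a} ha m hm => ha m (by simpa using hm))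
    (fun {a b} hb m hm => by
      classical
      obtain ⟨p, hp, q, hq, rfl⟩ := Finset.mem_mul.1
        (MonoidAlgebra.support_coeff_mul_subset a b (Finsupp.mem_support_iff.2 hm))
      obtain ⟨u, w, rfl⟩ := hb q (Finsupp.mem_support_iff.1 hq)
      exact ⟨p * u, w, by simp only [mul_assoc]⟩)
    (fun {a b} ha m hm => by
      classical
      obtain ⟨p, hp, q, hq, rfl⟩ := Finset.mem_mul.1
        (MonoidAlgebra.support_coeff_mul_subset a b (Finsupp.mem_support_iff.2 hm))
      obtain ⟨u, w, rfl⟩ := ha p (Finsupp.mem_support_iff.1 hp)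
      exact ⟨u, w * q, by simp only [mul_assoc]⟩)

theorem mem_supportIdeal {R : Type*} [Ring R] {M : Type*} [Monoid M] {t : M}
    {a : MonoidAlgebra R M} :
    a ∈ supportIdeal R t ↔ ∀ m, a.coeff m ≠ 0 → ∃ u w, m = u * t * w :=
  TwoSidedIdeal.mem_mk' ..

/-- The Okada algebra is graded by every monoid that satisfies its relations without scalars. -/
theorem exists_eq_mul_mul_of_freeIdeal_le {M : Type*} [Monoid M] (e : ℕ → M)
    (hsq : ∀ i, e i * e i = e i)
    (hcomm : ∀ i j, i + 2 ≤ j → e i * e j = e j * e i)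
    (hcontract : ∀ i, i + 1 < N → e (i + 1) * e i * e (i + 1) = e (i + 1))
    {S T : FibonacciSet N} (h : freeIdeal x y S ≤ freeIdeal x y T) :
    ∃ u w, (S.freeList.map e).prod = u * (T.freeList.map e).prod * w := by
  -- With coefficients in O_N itself, the scalars x_i and y_i are absorbed by the coefficient E_i,
  -- so e_i only has to satisfy the relations without scalars.
  let φ : OkadaAlgebra N x y →ₐ[K] MonoidAlgebra (OkadaAlgebra N x y) M :=
    lift x y (fun i => MonoidAlgebra.single (e i) (gen x y i))
      (fun i => by
        rw [MonoidAlgebra.single_mul_single, hsq, gen_mul_self, MonoidAlgebra.smul_single])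
      (fun i j hij => by
        rw [Commute, SemiconjBy, MonoidAlgebra.single_mul_single, MonoidAlgebra.single_mul_single,
          hcomm i j hij, (gen_commute x y i j (Or.inl hij)).eq])
      (fun i j hij => by
        rw [MonoidAlgebra.single_mul_single, MonoidAlgebra.single_mul_single,
          gen_contract x y i j hij, MonoidAlgebra.smul_single, hij,
          hcontract i (by rw [← hij]; exact j.2.2)])
  have hφ (l : List ℕ) (hl : ∀ i ∈ l, 1 ≤ i ∧ i < N) : φ (l.map (genAt x y)).prod =
      MonoidAlgebra.single (l.map e).prod (l.map (genAt x y)).prod := by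
    induction l with
    | nil => simp [MonoidAlgebra.one_def]
    | cons a l ih =>
      have ha := hl a (by simp)
      have h1 : φ (genAt x y a) = MonoidAlgebra.single (e a) (genAt x y a) := by
        rw [genAt, dif_pos ha]
        exact lift_gen x y (fun i : OkadaIndex N => MonoidAlgebra.single (e i) (gen x y i)) _ _ _
          ⟨a, ha⟩
      rw [List.map_cons, List.prod_cons, map_mul, ih fun i hi => hl i (by simp [hi]), h1,
        MonoidAlgebra.single_mul_single, List.map_cons, List.prod_cons]
  have hφ' (R : FibonacciSet N) : φ (freeElement x y R) =
      MonoidAlgebra.single (R.freeList.map e).prod (freeElement x y R) := by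
    rw [freeElement_eq_prod]
    refine hφ _ fun i hi => ?_
    have hi := FibonacciSet.mem_freeList.1 hi
    exact ⟨FibonacciSet.mem_freeSet_pos hi, FibonacciSet.mem_freeSet_lt hi⟩
  have hle : freeIdeal x y T ≤
      (supportIdeal (OkadaAlgebra N x y) (T.freeList.map e).prod).comap φ := by
    refine TwoSidedIdeal.span_le.2 (Set.singleton_subset_iff.2 ?_)
    rw [SetLike.mem_coe, TwoSidedIdeal.mem_comap, hφ', mem_supportIdeal]
    intro m hm
    refine ⟨1, 1, ?_⟩
    by_contra hne
    rw [one_mul, mul_one] at hne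
    exact hm (Finsupp.single_eq_of_ne hne)
  have hS := hle (h (TwoSidedIdeal.subset_span (Set.mem_singleton (freeElement x y S))))
  rw [TwoSidedIdeal.mem_comap, hφ', mem_supportIdeal] at hS
  -- The image of E_S is concentrated in the single degree e_S, with coefficient E_S ≠ 0, so this
  -- degree lies in M e_T M.
  refine hS _ ?_
  rw [MonoidAlgebra.coeff_single, Finsupp.single_eq_same]
  exact freeElement_ne_zero x y S

end OkadaAlgebra

theorem mainTheorem9 {K : Type*} [Field K] (N : ℕ) (x y : ℕ → K)
    (hy : ∀ i, 1 ≤ i → i + 2 ≤ N → y i ≠ 0) (S T : FibonacciSet N) :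
    OkadaAlgebra.freeIdeal x y S ≤ OkadaAlgebra.freeIdeal x y T ↔ S.DominatedBy T := by
  refine ⟨fun h => ?_, OkadaAlgebra.freeIdeal_le_of_dominatedBy x y hy⟩
  rw [FibonacciSet.dominatedBy_iff_card_freeSet_filter_le]
  intro m
  obtain ⟨u, w, huw⟩ := OkadaAlgebra.exists_eq_mul_mul_of_freeIdeal_le x y (PathForm.step N m)
    (PathForm.step_mul_self N m) (fun _ _ => PathForm.step_comm N m)
    (fun _ => PathForm.step_contract N m) h
  exact PathForm.card_filter_le_of_prod_step_eq huw
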